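/- **Theorem.** Let $c,e,m$ be integers with $m>1$. Let $k\ge 1$ and let $a_1,\dots,a_k$ be positive integers. For $0\le i\le k$ let $P_i$ and $Q_i$ be the canonical numerators and denominators of $[0;a_1,\dots,a_i]$, that is, $P_0=0$, $Q_0=1$, $P_1=1$, $Q_1=a_1$, and $P_i=a_iP_{i-1}+P_{i-2}$, $Q_i=a_iQ_{i-1}+Q_{i-2}$ for $i\ge 2$. Set $$C=Q_{k-1}+P_k+c\,Q_k,\qquad E=Q_{k-1}+P_k+e\,Q_k ,$$ and let $d$ be a positive rational such that $Cdm/E$ and $dm$ are positive integers (in particular $C,E\neq 0$). Put $$a=\frac{E-\sqrt{E^2+(-1)^k4E/C}}{2},\qquad b=\frac{E+\sqrt{E^2+(-1)^k4E/C}}{2},$$ where $\sqrt{\cdot}$ is the principal complex square root. If $k$ is odd, assume also that $mdQ_k+a\ne 0$ (if $k$ is even, this holds automatically). Then the infinite continued fraction $$\Bigl[0;\overline{a_1,\dots,a_k,\;c+\tfrac{C}{E}\,d\,m^{2n-1},\;a_1,\dots,a_k,\;e+d\,m^{2n}}\,\Bigr]_{n=1}^{\infty}$$ converges (the denominators of its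 convergents are eventually nonzero, and its convergents have a finite limit), and its value is $$\frac{P_k}{Q_k}+\frac{(-1)^kE/C}{Q_k\,(mdQ_k+a)}\cdot \frac{\displaystyle\sum_{n=0}^{\infty}\frac{(b/(dQ_k))^n\,m^{-n(n+3)/2}}{(1/m;1/m)_n\,(-a/(dQ_km^2);1/m)_n}} {\displaystyle\sum_{n=0}^{\infty}\frac{(b/(dQ_k))^n\,m^{-n(n+1)/2}}{(1/m;1/m)_n\,(-a/(dQ_km);1/m)_n}} .$$ Here $(z;q)_n=\prod_{j=0}^{n-1}(1-zq^j)$. All the $q$-products that occur are nonzero, both series converge, and the series in the denominator has a nonzero sum. -/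

import Mathlib

open Filter Topology

noncomputable section

/-- The infinite continued fraction `[0; b 0, b 1, b 2, …]`, all partial numerators being `1`. -/
def simpleCF (b : ℕ → ℝ) : GenContFract ℝ where
  h := 0
  s := ⟨fun n => some ⟨1, b n⟩, fun h => by simp at h⟩

/-- The continued fraction `g` converges to `L`: its denominators are eventually nonzero
and its convergents tend to `L`. -/
def CFConvergesTo (g : GenContFract ℝ) (L : ℂ) : Prop :=
  (∀ᶠ n in atTop, g.dens n ≠ 0) ∧ Tendsto (fun n => ((g.convs n : ℝ) : ℂ)) atTop (𝓝 L)

/-- Canonical numerator `P_i` of `1/x₁ + 1/x₂ + ⋯ + 1/x_i` (so `P_0 = 0`);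
it depends only on `x 1, …, x i`. -/
def cfNum (x : ℕ → ℕ) (i : ℕ) : ℝ := (simpleCF fun j => (x (j + 1) : ℝ)).nums i

/-- Canonical denominator `Q_i` of `1/x₁ + 1/x₂ + ⋯ + 1/x_i` (so `Q_0 = 1`). -/
def cfDen (x : ℕ → ℕ) (i : ℕ) : ℝ := (simpleCF fun j => (x (j + 1) : ℝ)).dens i

/-- The sequence `x 1, …, x k, u 1, x 1, …, x k, v 1, x 1, …, x k, u 2, x 1, …, x k, v 2, …`,
indexed from `0`. -/
def interlaced (k : ℕ) (x : ℕ → ℕ) (u v : ℕ → ℝ) (j : ℕ) : ℝ :=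
  if j % (k + 1) < k then (x (j % (k + 1) + 1) : ℝ)
  else if Even (j / (k + 1)) then u (j / (k + 1) / 2 + 1)
  else v (j / (k + 1) / 2 + 1)

/-- `(z; q)_n = ∏_{i < n} (1 - z q^i)`. -/
def qPoch (z q : ℂ) (n : ℕ) : ℂ := ∏ i ∈ Finset.range n, (1 - z * q ^ i)

/-- The term `y^n m^{-n(n+s)/2} / ((1/m; 1/m)_n (z; 1/m)_n)`; used for odd `s`, when
`n * (n + s)` is even. -/
def qTerm (s : ℕ) (y z m : ℂ) (n : ℕ) : ℂ :=
  y ^ n * (m ^ (n * (n + s) / 2))⁻¹ / (qPoch (1 / m) (1 / m) n * qPoch z (1 / m) n)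

end

/-! Put D = d Q_k, so that a + b = E and ab = -(-1)^k E/C. The q-series X_n (`minSol`) solve X_n =
(a + b + D m^(n+1)) X_(n+1) - ab X_(n+2) (`minSol_recurrence`) and decay faster than any geometric
sequence (`tendsto_mul_minSol`). Scaling X_n by a power of E/C that grows at every other step gives
Z_n = (Q_(k-1) + P_k + Q_k w_n) Z_(n+1) + (-1)^k Z_(n+2), with w_n the last partial quotient of the
n-th block. This is the recurrence of the continued fraction sampled once per block, so Z extends to
a null solution z of the full recurrence (`block_convergesTo`).

Partial quotients may be negative, so integrality replaces positivity: z_0 p_n - z_1 q_n = ±z_(n+1)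
tends to 0 while p_n, q_n are integers of determinant ±1, which forces p_n/q_n to tend to z_1/z_0
(`convergesTo_of_tendsto_zero`). Integrality also controls the zeros of the q-products
(`mul_pow_add_ne_zero`). -/

/-! ### Continuants: recurrence, determinant, integrality -/

theorem simpleCF_h (b : ℕ → ℝ) : (simpleCF b).h = 0 := rfl

theorem simpleCF_dens_zero (b : ℕ → ℝ) : (simpleCF b).dens 0 = 1 := rfl

theorem simpleCF_nums_one (b : ℕ → ℝ) : (simpleCF b).nums 1 = 1 := by
  have h := GenContFract.first_num_eq (g := simpleCF b) (gp := ⟨1, b 0⟩) rfl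
  simpa [simpleCF] using h

theorem simpleCF_dens_one (b : ℕ → ℝ) : (simpleCF b).dens 1 = b 0 :=
  GenContFract.first_den_eq (g := simpleCF b) (gp := ⟨1, b 0⟩) rfl

theorem simpleCF_nums_add_two (b : ℕ → ℝ) (n : ℕ) :
    (simpleCF b).nums (n + 2) = b (n + 1) * (simpleCF b).nums (n + 1) + (simpleCF b).nums n := by
  have h := GenContFract.nums_recurrence (g := simpleCF b) (n := n) (gp := ⟨1, b (n + 1)⟩)
    rfl rfl rfl
  simpa using h

theorem simpleCF_dens_add_two (b : ℕ → ℝ) (n : ℕ) :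
    (simpleCF b).dens (n + 2) = b (n + 1) * (simpleCF b).dens (n + 1) + (simpleCF b).dens n := by
  have h := GenContFract.dens_recurrence (g := simpleCF b) (n := n) (gp := ⟨1, b (n + 1)⟩)
    rfl rfl rfl
  simpa using h

theorem simpleCF_det (b : ℕ → ℝ) (n : ℕ) :
    (simpleCF b).nums (n + 1) * (simpleCF b).dens n
      - (simpleCF b).nums n * (simpleCF b).dens (n + 1) = (-1) ^ n := by
  induction n with
  | zero => simp [simpleCF_h, simpleCF_nums_one]
  | succ n ih =>
    rw [simpleCF_nums_add_two, simpleCF_dens_add_two, pow_succ, ← ih]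
    ring

theorem simpleCF_exists_int (b : ℕ → ℝ) (hb : ∀ n, ∃ i : ℤ, b n = i) (n : ℕ) :
    (∃ p : ℤ, (simpleCF b).nums n = p) ∧ ∃ q : ℤ, (simpleCF b).dens n = q := by
  induction n using Nat.twoStepInduction with
  | zero => exact ⟨⟨0, by simp [simpleCF_h]⟩, ⟨1, by simp⟩⟩
  | one =>
    obtain ⟨i, hi⟩ := hb 0
    exact ⟨⟨1, by simp [simpleCF_nums_one]⟩, ⟨i, by simp [simpleCF_dens_one, hi]⟩⟩
  | more n h1 h2 =>
    obtain ⟨⟨p, hp⟩, q, hq⟩ := h1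
    obtain ⟨⟨p', hp'⟩, q', hq'⟩ := h2
    obtain ⟨i, hi⟩ := hb (n + 1)
    refine ⟨⟨i * p' + p, ?_⟩, ⟨i * q' + q, ?_⟩⟩
    · rw [simpleCF_nums_add_two, hp, hp', hi]; push_cast; ring
    · rw [simpleCF_dens_add_two, hq, hq', hi]; push_cast; ring

/-! ### Convergence from a null solution -/

/-- A solution of `z j = b j * z (j + 1) + z (j + 2)` on an initial segment is expressed
through the continuants of `b`. -/
theorem nums_mul_sub_dens_mul (b : ℕ → ℝ) (z : ℕ → ℂ) (k : ℕ)
    (hz : ∀ j, j < k → z j = b j * z (j + 1) + z (j + 2)) (n : ℕ) (hn : n ≤ k) :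
    z 0 * ((simpleCF b).nums n : ℝ) - z 1 * ((simpleCF b).dens n : ℝ)
      = (-1) ^ (n + 1) * z (n + 1) := by
  induction n using Nat.twoStepInduction with
  | zero => simp [simpleCF_h]
  | one =>
    have := hz 0 (by omega)
    simp only [simpleCF_nums_one, simpleCF_dens_one]
    rw [this]; push_cast; ring
  | more n h1 h2 =>
    have h1 := h1 (by omega)
    have h2 := h2 (by omega)
    have := hz (n + 1) (by omega)
    rw [simpleCF_nums_add_two, simpleCF_dens_add_two]
    push_cast
    rw [show (-1 : ℂ) ^ (n + 2 + 1) = (-1) ^ (n + 1) by ring]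
    have h3 : (-1 : ℂ) ^ (n + 1 + 1) = - (-1) ^ (n + 1) := by ring
    rw [h3] at h2
    rw [show n + 2 + 1 = n + 1 + 2 by ring]
    linear_combination (b (n + 1) : ℂ) * h2 + h1 + (-1) ^ (n + 1) * this

theorem int_cast_eq_zero_of_abs_lt_one {r : ℝ} (h : ∃ i : ℤ, r = i) (hr : |r| < 1) : r = 0 := by
  obtain ⟨i, rfl⟩ := h
  have : |i| < 1 := by exact_mod_cast hr
  simp [Int.abs_lt_one_iff.1 this]

/-- A Pincherle-type criterion for integer partial quotients: a nonzero solution of the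
recurrence that tends to zero gives the value of the continued fraction. -/
theorem convergesTo_of_tendsto_zero (b : ℕ → ℝ) (hb : ∀ n, ∃ i : ℤ, b n = i) (z : ℕ → ℂ)
    (hz : ∀ j, z j = b j * z (j + 1) + z (j + 2)) (hlim : Tendsto z atTop (𝓝 0))
    (hne : z 0 ≠ 0 ∨ z 1 ≠ 0) :
    z 0 ≠ 0 ∧ CFConvergesTo (simpleCF b) (z 1 / z 0) := by
  have key : ∀ n, z 0 * ((simpleCF b).nums n : ℝ) - z 1 * ((simpleCF b).dens n : ℝ)
      = (-1) ^ (n + 1) * z (n + 1) := fun n =>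
    nums_mul_sub_dens_mul b z n (fun j _ => hz j) n le_rfl
  have hnorm : ∀ n, ‖z 0 * ((simpleCF b).nums n : ℝ) - z 1 * ((simpleCF b).dens n : ℝ)‖
      = ‖z (n + 1)‖ := fun n => by rw [key]; simp
  have hsmall : ∀ r : ℝ, 0 < r → ∀ᶠ n in atTop, ‖z (n + 1)‖ < r := fun r hr => by
    have := (tendsto_add_atTop_iff_nat 1).2 hlim
    exact (tendsto_zero_iff_norm_tendsto_zero.1 this).eventually (gt_mem_nhds hr)
  have hdet := simpleCF_det b
  -- If z_0 = 0, then z_1 q_n tends to 0, so the integers q_n are eventually 0, against the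
  -- determinant.
  have h0 : z 0 ≠ 0 := by
    intro h0
    have h1 : z 1 ≠ 0 := hne.resolve_left (by simpa using h0)
    have hz0 : ∀ᶠ n in atTop, (simpleCF b).dens n = 0 := by
      filter_upwards [hsmall _ (norm_pos_iff.2 h1)] with n hn
      refine int_cast_eq_zero_of_abs_lt_one (simpleCF_exists_int b hb n).2 ?_
      have := hnorm n
      rw [h0, zero_mul, zero_sub, norm_neg, norm_mul, Complex.norm_real, Real.norm_eq_abs] at this
      rw [← this] at hn
      exact (mul_lt_iff_lt_one_right (norm_pos_iff.2 h1)).1 hn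
    obtain ⟨N, hN⟩ := eventually_atTop.1 hz0
    have := hdet N
    rw [hN N le_rfl, hN (N + 1) (by omega)] at this
    simp at this
    exact absurd this.symm (by simp)
  -- If q_n = 0 for large n, then z_0 p_n is small and p_n = 0 too, again against the determinant.
  have hd : ∀ᶠ n in atTop, (simpleCF b).dens n ≠ 0 := by
    filter_upwards [hsmall _ (norm_pos_iff.2 h0)] with n hn hd
    have h1 : (simpleCF b).nums n = 0 := by
      refine int_cast_eq_zero_of_abs_lt_one (simpleCF_exists_int b hb n).1 ?_
      have := hnorm n
      rw [hd, Complex.ofReal_zero, mul_zero, sub_zero, norm_mul, Complex.norm_real,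
        Real.norm_eq_abs] at this
      rw [← this] at hn
      exact (mul_lt_iff_lt_one_right (norm_pos_iff.2 h0)).1 hn
    have := hdet n
    rw [h1, hd] at this
    simp at this
    exact absurd this.symm (by simp)
  refine ⟨h0, hd, ?_⟩
  rw [tendsto_iff_norm_sub_tendsto_zero]
  have hl : Tendsto (fun n => ‖z (n + 1)‖ / ‖z 0‖) atTop (𝓝 0) := by
    have := tendsto_zero_iff_norm_tendsto_zero.1 ((tendsto_add_atTop_iff_nat 1).2 hlim)
    simpa using this.div_const ‖z 0‖
  refine squeeze_zero' (Eventually.of_forall fun _ => norm_nonneg _) ?_ hl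
  filter_upwards [hd] with n hn
  have h1 : (1 : ℝ) ≤ |(simpleCF b).dens n| := by
    by_contra! h
    exact hn (int_cast_eq_zero_of_abs_lt_one (simpleCF_exists_int b hb n).2 h)
  have hnC : ((simpleCF b).dens n : ℂ) ≠ 0 := by exact_mod_cast hn
  have : (((simpleCF b).convs n : ℝ) : ℂ) - z 1 / z 0
      = (z 0 * ((simpleCF b).nums n : ℝ) - z 1 * ((simpleCF b).dens n : ℝ))
        / (z 0 * ((simpleCF b).dens n : ℝ)) := by
    rw [GenContFract.conv_eq_num_div_den]
    push_cast
    field_simp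
  rw [this, norm_div, hnorm, norm_mul, Complex.norm_real, Real.norm_eq_abs]
  have h0' := norm_pos_iff.2 h0
  gcongr
  exact le_mul_of_one_le_right h0'.le h1

/-! ### The q-series as a minimal solution -/

/-- `∏_{j = 1}^{n} (D m^j + a)`. -/
def shiftedProd (a D m : ℂ) (n : ℕ) : ℂ := ∏ j ∈ Finset.range n, (D * m ^ (j + 1) + a)

/-- The term `b^i / ((1/m; 1/m)_i ∏_{j = 1}^{n + i} (D m^j + a))`. -/
noncomputable def minTerm (a b D m : ℂ) (n i : ℕ) : ℂ :=
  b ^ i / (qPoch (1 / m) (1 / m) i * shiftedProd a D m (n + i))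

/-- The series of the `minTerm`s, a minimal solution of
`X n = (a + b + D m^(n+1)) X (n+1) - a b X (n+2)`. -/
noncomputable def minSol (a b D m : ℂ) (n : ℕ) : ℂ := ∑' i, minTerm a b D m n i

theorem shiftedProd_succ (a D m : ℂ) (n : ℕ) :
    shiftedProd a D m (n + 1) = shiftedProd a D m n * (D * m ^ (n + 1) + a) :=
  Finset.prod_range_succ _ _

theorem shiftedProd_ne_zero {a D m : ℂ} (h : ∀ n : ℕ, D * m ^ (n + 1) + a ≠ 0) (n : ℕ) :
    shiftedProd a D m n ≠ 0 :=
  Finset.prod_ne_zero_iff.2 fun j _ => h j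

theorem qPoch_succ (z q : ℂ) (n : ℕ) : qPoch z q (n + 1) = qPoch z q n * (1 - z * q ^ n) :=
  Finset.prod_range_succ _ _

theorem half_le_norm_one_sub {m : ℂ} (hm : 2 ≤ ‖m‖) (n : ℕ) :
    1 / 2 ≤ ‖1 - 1 / m * (1 / m) ^ n‖ := by
  have h1 : ‖1 / m‖ ≤ 1 / 2 := by
    rw [norm_div, norm_one]; exact one_div_le_one_div_of_le (by norm_num) hm
  have h2 : ‖1 / m * (1 / m) ^ n‖ ≤ 1 / 2 := by
    rw [norm_mul, norm_pow]
    exact (mul_le_of_le_one_right (norm_nonneg _)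
      (pow_le_one₀ (norm_nonneg _) (h1.trans (by norm_num)))).trans h1
  have := norm_sub_norm_le (1 : ℂ) (1 / m * (1 / m) ^ n)
  rw [norm_one] at this
  linarith

theorem one_sub_ne_zero {m : ℂ} (hm : 2 ≤ ‖m‖) (n : ℕ) : 1 - 1 / m * (1 / m) ^ n ≠ 0 := by
  have := half_le_norm_one_sub hm n
  exact norm_pos_iff.1 (by linarith)

theorem qPoch_self_ne_zero {m : ℂ} (hm : 2 ≤ ‖m‖) (n : ℕ) : qPoch (1 / m) (1 / m) n ≠ 0 :=
  Finset.prod_ne_zero_iff.2 fun j _ => one_sub_ne_zero hm j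

theorem ne_zero_of_two_le_norm {m : ℂ} (hm : 2 ≤ ‖m‖) : m ≠ 0 := by
  rintro rfl; norm_num at hm

/-- Pull D m^j out of each factor with n < j ≤ n + i; these exponents sum to i(i + 2n + 1)/2. -/
theorem shiftedProd_mul_qPoch {a D m : ℂ} (hD : D ≠ 0) (hm : m ≠ 0) (n i : ℕ) :
    shiftedProd a D m (n + i) = shiftedProd a D m n *
      (D ^ i * m ^ (i * (i + (2 * n + 1)) / 2) * qPoch (-a / (D * m ^ (n + 1))) (1 / m) i) := by
  induction i with
  | zero => simp [qPoch]
  | succ i ih =>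
    have h : (i + 1) * (i + 1 + (2 * n + 1)) / 2 = i * (i + (2 * n + 1)) / 2 + (n + i + 1) := by
      rw [show (i + 1) * (i + 1 + (2 * n + 1)) = i * (i + (2 * n + 1)) + (n + i + 1) * 2 by ring,
        Nat.add_mul_div_right _ _ (by norm_num)]
    rw [← add_assoc, shiftedProd_succ, ih, h, qPoch_succ]
    have : D * m ^ (n + i + 1) + a =
        D * m ^ (n + i + 1) * (1 - -a / (D * m ^ (n + 1)) * (1 / m) ^ i) := by
      rw [one_div, inv_pow]
      field_simp
      ring
    rw [this]
    ring

theorem qPoch_ne_zero {a D m : ℂ} (hD : D ≠ 0) (hm : m ≠ 0)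
    (h : ∀ n : ℕ, D * m ^ (n + 1) + a ≠ 0) (n i : ℕ) :
    qPoch (-a / (D * m ^ (n + 1))) (1 / m) i ≠ 0 := by
  intro h0
  have := shiftedProd_mul_qPoch (a := a) hD hm n i
  rw [h0, mul_zero, mul_zero] at this
  exact shiftedProd_ne_zero h _ this

/-- The two series of the theorem are the cases n = 0 (s = 1) and n = 1 (s = 3). -/
theorem qTerm_eq_minTerm {a b D m : ℂ} (hD : D ≠ 0) (hm : m ≠ 0)
    (h : ∀ n : ℕ, D * m ^ (n + 1) + a ≠ 0) (n i : ℕ) :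
    qTerm (2 * n + 1) (b / D) (-a / (D * m ^ (n + 1))) m i
      = shiftedProd a D m n * minTerm a b D m n i := by
  have h1 := shiftedProd_ne_zero h n
  rw [minTerm, shiftedProd_mul_qPoch hD hm, qTerm, div_pow]
  have h2 : m ^ (i * (i + (2 * n + 1)) / 2) ≠ 0 := pow_ne_zero _ hm
  have h3 : D ^ i ≠ 0 := pow_ne_zero _ hD
  have h4 := qPoch_ne_zero hD hm h n i
  by_cases h5 : qPoch (1 / m) (1 / m) i = 0
  · simp only [h5, zero_mul, div_zero, mul_zero]
  generalize m ^ (i * (i + (2 * n + 1)) / 2) = M at *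
  field_simp

theorem tendsto_norm_mul_pow_add {a D m : ℂ} (hD : D ≠ 0) (hm : 2 ≤ ‖m‖) :
    Tendsto (fun n : ℕ => ‖D * m ^ (n + 1) + a‖) atTop atTop := by
  have h1 : Tendsto (fun n : ℕ => ‖D‖ * ‖m‖ ^ (n + 1) - ‖a‖) atTop atTop := by
    refine tendsto_atTop_add_const_right _ _ (Tendsto.const_mul_atTop (norm_pos_iff.2 hD) ?_)
    exact (tendsto_pow_atTop_atTop_of_one_lt (by linarith)).comp (tendsto_add_atTop_nat 1)
  refine tendsto_atTop_mono (fun n => ?_) h1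
  have := norm_sub_norm_le (D * m ^ (n + 1)) (-a)
  rwa [sub_neg_eq_add, norm_neg, norm_mul, norm_pow] at this

theorem minTerm_succ_right {a b D m : ℂ} (n i : ℕ) :
    minTerm a b D m n (i + 1) = minTerm a b D m n i *
      (b / ((1 - 1 / m * (1 / m) ^ i) * (D * m ^ (n + i + 1) + a))) := by
  rw [minTerm, minTerm, qPoch_succ, ← add_assoc, shiftedProd_succ, div_mul_div_comm, pow_succ]
  congr 1
  ring

theorem norm_minTerm_ratio_le {a b D m : ℂ} (hm : 2 ≤ ‖m‖) {R : ℝ} (hR : 0 < R) {n : ℕ}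
    (hn : R ≤ ‖D * m ^ (n + 1) + a‖) (i : ℕ) :
    ‖b / ((1 - 1 / m * (1 / m) ^ i) * (D * m ^ (n + 1) + a))‖ ≤ 2 * ‖b‖ / R := by
  have h1 := half_le_norm_one_sub hm i
  rw [norm_div, norm_mul]
  calc ‖b‖ / (‖1 - 1 / m * (1 / m) ^ i‖ * ‖D * m ^ (n + 1) + a‖)
      ≤ ‖b‖ / (1 / 2 * R) := by gcongr
    _ = 2 * ‖b‖ / R := by field_simp

theorem eventually_norm_minTerm_ratio_le {a b D m : ℂ} (hD : D ≠ 0) (hm : 2 ≤ ‖m‖) :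
    ∀ᶠ n : ℕ in atTop, ∀ i,
      ‖b / ((1 - 1 / m * (1 / m) ^ i) * (D * m ^ (n + 1) + a))‖ ≤ 1 / 4 := by
  -- The +1 keeps the bound positive when b = 0.
  filter_upwards [(tendsto_norm_mul_pow_add (a := a) hD hm).eventually_ge_atTop
    (8 * (‖b‖ + 1))] with n hn i
  have hb := norm_nonneg b
  refine (norm_minTerm_ratio_le hm (by positivity) hn i).trans ?_
  rw [div_le_iff₀ (by positivity)]
  linarith

theorem summable_minTerm {a b D m : ℂ} (hD : D ≠ 0) (hm : 2 ≤ ‖m‖) (n : ℕ) :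
    Summable (minTerm a b D m n) := by
  refine summable_of_ratio_norm_eventually_le (r := 1 / 4) (by norm_num) ?_
  have h := (tendsto_add_atTop_nat n).eventually
    (eventually_norm_minTerm_ratio_le (a := a) (b := b) hD hm)
  filter_upwards [h] with i hi
  rw [minTerm_succ_right, norm_mul, mul_comm, add_comm n i]
  exact mul_le_mul_of_nonneg_right (hi i) (norm_nonneg _)

theorem minTerm_succ_mul_one_sub {a b D m : ℂ} (hm : 2 ≤ ‖m‖) (n i : ℕ) :
    minTerm a b D m n (i + 1) * (1 - (1 / m) ^ (i + 1)) = b * minTerm a b D m (n + 1) i := by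
  have h1 := one_sub_ne_zero hm i
  rw [minTerm, minTerm, qPoch_succ, pow_succ' (1 / m), pow_succ' b,
    show n + (i + 1) = n + 1 + i by ring]
  have h2 := qPoch_self_ne_zero hm i
  generalize 1 - 1 / m * (1 / m) ^ i = w at *
  by_cases h3 : shiftedProd a D m (n + 1 + i) = 0
  · simp [h3]
  field_simp

/-- The weight 1 - m^(-i) cancels the last factor of (1/m; 1/m)_i and kills the term i = 0, so the
weighted sum is a shifted series. -/
theorem hasSum_minTerm_mul_pow {a b D m : ℂ} (hD : D ≠ 0) (hm : 2 ≤ ‖m‖) (n : ℕ) :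
    HasSum (fun i => minTerm a b D m n i * (1 / m) ^ i)
      (minSol a b D m n - b * minSol a b D m (n + 1)) := by
  have h1 : HasSum (fun i => minTerm a b D m n i * (1 - (1 / m) ^ i))
      (b * minSol a b D m (n + 1)) := by
    rw [← hasSum_nat_add_iff' 1]
    simp only [minTerm_succ_mul_one_sub hm, Finset.sum_range_one, pow_zero, sub_self, mul_zero,
      sub_zero]
    exact (summable_minTerm hD hm (n + 1)).hasSum.mul_left b
  have h2 := (summable_minTerm (a := a) (b := b) hD hm n).hasSum.sub h1
  refine h2.congr_fun ?_
  intro i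
  ring

/-- Evaluate the sum of m^(-i) t_(n,i) twice: as X_n - b X_(n+1), and, using t_(n,i) = (D m^(n+i+1)
+ a) t_(n+1,i), as D m^(n+1) X_(n+1) + a (X_(n+1) - b X_(n+2)). -/
theorem minSol_recurrence {a b D m : ℂ} (hD : D ≠ 0) (hm : 2 ≤ ‖m‖)
    (h : ∀ n : ℕ, D * m ^ (n + 1) + a ≠ 0) (n : ℕ) :
    minSol a b D m n = (a + b + D * m ^ (n + 1)) * minSol a b D m (n + 1)
      - a * b * minSol a b D m (n + 2) := by
  have hm0 := ne_zero_of_two_le_norm hm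
  have h1 := hasSum_minTerm_mul_pow (a := a) (b := b) hD hm n
  have h2 := (hasSum_minTerm_mul_pow (a := a) (b := b) hD hm (n + 1)).mul_left a
  have h3 := (summable_minTerm (a := a) (b := b) hD hm (n + 1)).hasSum.mul_left (D * m ^ (n + 1))
  have h4 : ∀ i, minTerm a b D m n i * (1 / m) ^ i
      = D * m ^ (n + 1) * minTerm a b D m (n + 1) i
        + a * (minTerm a b D m (n + 1) i * (1 / m) ^ i) := by
    intro i
    rw [minTerm, minTerm, show n + 1 + i = n + i + 1 by ring, shiftedProd_succ]
    have h5 := shiftedProd_ne_zero h (n + i)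
    have h6 := h (n + i)
    have h7 := qPoch_self_ne_zero hm i
    have h8 : D * m ^ (n + 1) = D * m ^ (n + i + 1) * (1 / m) ^ i := by
      rw [one_div, inv_pow]
      field_simp
      ring
    rw [h8]
    generalize (1 / m) ^ i = w
    generalize m ^ (n + i + 1) = v at *
    field_simp
  have h5 := h1.unique ((h3.add h2).congr_fun h4)
  rw [← minSol] at h5
  linear_combination h5

/-- After normalization the leading term is 1 and the others are dominated by 1/4 + 1/16 + ... =
1/3. -/
theorem norm_minSol_sub_one_le {a b D m : ℂ} (hD : D ≠ 0) (hm : 2 ≤ ‖m‖)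
    (h : ∀ n : ℕ, D * m ^ (n + 1) + a ≠ 0) :
    ∀ᶠ n : ℕ in atTop, ‖shiftedProd a D m n * minSol a b D m n - 1‖ ≤ 1 / 3 := by
  obtain ⟨N, hN⟩ := eventually_atTop.1 (eventually_norm_minTerm_ratio_le (a := a) (b := b) hD hm)
  filter_upwards [eventually_ge_atTop N] with n hn
  have h0 := shiftedProd_ne_zero h n
  have hbound : ∀ i, ‖shiftedProd a D m n * minTerm a b D m n i‖ ≤ (1 / 4) ^ i := by
    intro i
    induction i with
    | zero => simp [minTerm, qPoch, h0]
    | succ i ih =>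
      rw [minTerm_succ_right, ← mul_assoc, norm_mul, pow_succ]
      exact mul_le_mul ih (hN (n + i) (by omega) i) (norm_nonneg _) (pow_nonneg (by norm_num) i)
  have hs := (summable_minTerm (a := a) (b := b) hD hm n).hasSum.mul_left (shiftedProd a D m n)
  rw [← hasSum_nat_add_iff' 1] at hs
  have h1 : shiftedProd a D m n * minTerm a b D m n 0 = 1 := by simp [minTerm, qPoch, h0]
  rw [Finset.sum_range_one, h1] at hs
  rw [minSol, ← hs.tsum_eq]
  have hg : HasSum (fun i : ℕ => (1 / 4 : ℝ) ^ (i + 1)) (1 / 3) := by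
    have := (hasSum_geometric_of_lt_one (r := (1 / 4 : ℝ)) (by norm_num) (by norm_num)).mul_right
      (1 / 4)
    norm_num at this ⊢
    simpa [pow_succ, div_eq_mul_inv] using this
  exact tsum_of_norm_bounded hg fun i => hbound (i + 1)

/-- As ab ≠ 0, two initial zeros would propagate to all n, contradicting the asymptotics. -/
theorem minSol_ne_zero_or {a b D m : ℂ} (hD : D ≠ 0) (hm : 2 ≤ ‖m‖)
    (h : ∀ n : ℕ, D * m ^ (n + 1) + a ≠ 0) (ha : a ≠ 0) (hb : b ≠ 0) :
    minSol a b D m 0 ≠ 0 ∨ minSol a b D m 1 ≠ 0 := by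
  by_contra! hc
  have hall : ∀ n, minSol a b D m n = 0 := by
    intro n
    induction n using Nat.twoStepInduction with
    | zero => exact hc.1
    | one => exact hc.2
    | more n h1 h2 =>
      have := minSol_recurrence (b := b) hD hm h n
      rw [h1, h2] at this
      simpa [ha, hb] using this
  obtain ⟨n, hn⟩ := (norm_minSol_sub_one_le (b := b) hD hm h).exists
  rw [hall n] at hn
  norm_num at hn

/-- The minimal solution beats every factor with bounded ratios. -/
theorem tendsto_mul_minSol {a b D m : ℂ} (hD : D ≠ 0) (hm : 2 ≤ ‖m‖)
    (h : ∀ n : ℕ, D * m ^ (n + 1) + a ≠ 0) (μ : ℕ → ℂ) (K : ℝ)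
    (hμ : ∀ n, ‖μ (n + 1)‖ ≤ K * ‖μ n‖) :
    Tendsto (fun n => μ n * minSol a b D m n) atTop (𝓝 0) := by
  have h1 : Tendsto (fun n => μ n / shiftedProd a D m n) atTop (𝓝 0) := by
    refine Summable.tendsto_atTop_zero ?_
    refine summable_of_ratio_norm_eventually_le (r := 1 / 2) (by norm_num) ?_
    filter_upwards [(tendsto_norm_mul_pow_add (a := a) hD hm).eventually_ge_atTop (2 * K)]
      with n hn
    have h2 := norm_pos_iff.2 (h n)
    have h3 := norm_pos_iff.2 (shiftedProd_ne_zero h n)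
    rw [shiftedProd_succ, norm_div, norm_div, norm_mul, ← mul_div_assoc,
      div_le_div_iff₀ (by positivity) h3]
    have h4 : ‖μ (n + 1)‖ ≤ 1 / 2 * ‖μ n‖ * ‖D * m ^ (n + 1) + a‖ := by
      refine (hμ n).trans ?_
      have := mul_le_mul_of_nonneg_left hn (norm_nonneg (μ n))
      linarith
    have := mul_le_mul_of_nonneg_right h4 h3.le
    linarith
  have h2 : IsBoundedUnder (· ≤ ·) atTop
      (fun n => ‖shiftedProd a D m n * minSol a b D m n‖) := by
    refine ⟨4 / 3, eventually_map.2 ?_⟩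
    filter_upwards [norm_minSol_sub_one_le (b := b) hD hm h] with n hn
    have := norm_sub_norm_le (shiftedProd a D m n * minSol a b D m n) 1
    rw [norm_one] at this
    linarith
  refine (h1.zero_mul_isBoundedUnder_le h2).congr fun n => ?_
  have := shiftedProd_ne_zero h n
  field_simp

/-! ### From blocks to the whole continued fraction -/

/-- The solution of `z j = b j * z (j + 1) + z (j + 2)` with given initial values. -/
def forwardSol (b : ℕ → ℝ) (z₀ z₁ : ℂ) : ℕ → ℂ
  | 0 => z₀
  | 1 => z₁
  | n + 2 => forwardSol b z₀ z₁ n - b n * forwardSol b z₀ z₁ (n + 1)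

theorem forwardSol_recurrence (b : ℕ → ℝ) (z₀ z₁ : ℂ) (j : ℕ) :
    forwardSol b z₀ z₁ j = b j * forwardSol b z₀ z₁ (j + 1) + forwardSol b z₀ z₁ (j + 2) := by
  rw [forwardSol.eq_3]; ring

theorem cfDen_det (x : ℕ → ℕ) (i : ℕ) :
    cfNum x (i + 1) * cfDen x i - cfNum x i * cfDen x (i + 1) = (-1) ^ i :=
  simpleCF_det _ i

theorem one_le_cfDen (x : ℕ → ℕ) (k : ℕ) (hx : ∀ i, 1 ≤ i → i ≤ k → 0 < x i) (i : ℕ)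
    (hi : i ≤ k) : 1 ≤ cfDen x i := by
  induction i using Nat.twoStepInduction with
  | zero => exact (simpleCF_dens_zero _).ge
  | one =>
    rw [cfDen, simpleCF_dens_one]
    exact_mod_cast hx 1 le_rfl hi
  | more i h1 h2 =>
    have h1 := h1 (by omega)
    have h2 := h2 (by omega)
    have h3 : (1 : ℝ) ≤ x (i + 1 + 1) := by exact_mod_cast hx (i + 2) (by omega) hi
    unfold cfDen at *
    rw [simpleCF_dens_add_two]
    nlinarith

theorem two_le_cfDen (x : ℕ → ℕ) (k : ℕ) (hx : ∀ i, 1 ≤ i → i ≤ k → 0 < x i) (hk : 2 ≤ k) :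
    2 ≤ cfDen x k := by
  obtain ⟨l, rfl⟩ := Nat.exists_eq_add_of_le' hk
  have h1 := one_le_cfDen x _ hx l (by omega)
  have h2 := one_le_cfDen x _ hx (l + 1) (by omega)
  have h3 : (1 : ℝ) ≤ x (l + 1 + 1) := by exact_mod_cast hx (l + 2) (by omega) le_rfl
  unfold cfDen at *
  rw [simpleCF_dens_add_two]
  nlinarith

/-- Reduction of a continued fraction with repeated blocks `x 1, …, x k, w n` to a
three-term recurrence indexed by the blocks. -/
theorem block_convergesTo (k : ℕ) (hk : 1 ≤ k) (x : ℕ → ℕ) (hQ : cfDen x k ≠ 0)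
    (β w : ℕ → ℝ) (hβ : ∀ n, ∃ i : ℤ, β n = i)
    (hβx : ∀ n j, j < k → β (n * (k + 1) + j) = x (j + 1))
    (hβw : ∀ n, β (n * (k + 1) + k) = w n) (Z : ℕ → ℂ)
    (hZ : ∀ n, Z n = (cfDen x (k - 1) + cfNum x k + cfDen x k * w n) * Z (n + 1)
      + (-1) ^ k * Z (n + 2))
    (hlim : Tendsto Z atTop (𝓝 0)) (hne : Z 0 ≠ 0 ∨ Z 1 ≠ 0) :
    Z 0 ≠ 0 ∧ CFConvergesTo (simpleCF β)
      ((cfNum x k + (-1) ^ k * Z 1 / Z 0) / cfDen x k) := by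
  obtain ⟨l, rfl⟩ := Nat.exists_eq_add_of_le' hk
  rw [Nat.add_sub_cancel] at hZ
  have hQC : (cfDen x (l + 1) : ℂ) ≠ 0 := by exact_mod_cast hQ
  have hsq : ((-1 : ℂ) ^ (l + 1)) * (-1) ^ (l + 1) = 1 := by
    rw [← mul_pow]; simp
  -- The second value in block n, as forced by z P_k - z' Q_k = (-1)^(k+1) Z_(n+1), where z = Z_n
  -- and z' are the first two values.
  set W : ℕ → ℂ := fun n =>
    (cfNum x (l + 1) * Z n + (-1) ^ (l + 1) * Z (n + 1)) / cfDen x (l + 1) with hW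
  have hWmul : ∀ n, cfDen x (l + 1) * W n
      = cfNum x (l + 1) * Z n + (-1) ^ (l + 1) * Z (n + 1) := fun n => by
    simp only [hW]; field_simp
  set z := forwardSol β (Z 0) (W 0) with hz
  have hrec : ∀ j, z j = β j * z (j + 1) + z (j + 2) := forwardSol_recurrence β _ _
  have hdet : (cfNum x (l + 1) * cfDen x l - cfNum x l * cfDen x (l + 1) : ℂ) = (-1) ^ l := by
    exact_mod_cast cfDen_det x l
  have hblock : ∀ n, z (n * (l + 1 + 1)) = Z n ∧ z (n * (l + 1 + 1) + 1) = W n := by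
    intro n
    induction n with
    | zero => simp [hz, forwardSol]
    | succ n ih =>
      obtain ⟨ih0, ih1⟩ := ih
      have hstep := nums_mul_sub_dens_mul (fun j => (x (j + 1) : ℝ))
        (fun j => z (n * (l + 1 + 1) + j)) (l + 1) (fun j hj => by
          have := hrec (n * (l + 1 + 1) + j)
          rw [hβx n j hj] at this
          exact this)
      have h1 := hstep l (by omega)
      have h2 := hstep (l + 1) le_rfl
      simp only [add_zero, ih0, ih1] at h1 h2
      change Z n * (cfNum x l : ℝ) - W n * (cfDen x l : ℝ) = _ at h1
      change Z n * (cfNum x (l + 1) : ℝ) - W n * (cfDen x (l + 1) : ℝ) = _ at h2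
      have h3 := hrec (n * (l + 1 + 1) + (l + 1))
      rw [hβw] at h3
      have e1 : (n + 1) * (l + 1 + 1) = n * (l + 1 + 1) + (l + 1 + 1) := by ring
      have hZn : z ((n + 1) * (l + 1 + 1)) = Z (n + 1) := by
        rw [e1]
        have := hWmul n
        rw [pow_succ (-1 : ℂ) (l + 1)] at h2
        linear_combination (-1) ^ (l + 1) * h2 + (-1) ^ (l + 1) * this
          + (Z (n + 1) - z (n * (l + 1 + 1) + (l + 1 + 1))) * hsq
      refine ⟨hZn, ?_⟩
      apply mul_left_cancel₀ hQC
      rw [hWmul]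
      have e2 : n * (l + 1 + 1) + (l + 1) + 2 = (n + 1) * (l + 1 + 1) + 1 := by ring
      have e3 : n * (l + 1 + 1) + (l + 1) + 1 = (n + 1) * (l + 1 + 1) := by ring
      rw [e2, e3, hZn] at h3
      have h4 := hZ n
      have h5 := hWmul n
      have h6 : (-1 : ℂ) ^ (l + 1) = - (-1) ^ l := by ring
      have h7 : ((-1 : ℂ) ^ l) * (-1) ^ l = 1 := by rw [← mul_pow]; simp
      rw [h6] at h1 h4 h5 ⊢
      generalize (-1 : ℂ) ^ l = s at *
      generalize z (n * (l + 1 + 1) + (l + 1)) = ζ at *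
      linear_combination (-cfDen x (l + 1) : ℂ) * h3 + h4
        + s * (cfDen x (l + 1) * h1 + cfDen x l * h5 + Z n * hdet)
        - (cfDen x (l + 1) * ζ - Z n + cfDen x l * Z (n + 1)) * h7
  have hz0 : z 0 = Z 0 := rfl
  have hz1 : z 1 = W 0 := rfl
  have hWlim : Tendsto W atTop (𝓝 0) := by
    have h1 := (((hlim.const_mul (cfNum x (l + 1) : ℂ)).add
      (((tendsto_add_atTop_iff_nat 1).2 hlim).const_mul ((-1 : ℂ) ^ (l + 1)))).div_const
        (cfDen x (l + 1) : ℂ))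
    simpa using h1
  -- Inside a block the coefficients do not depend on n, so decay passes from the first two
  -- positions to the others.
  have hres : ∀ r, r ≤ l + 1 → Tendsto (fun n => z (n * (l + 1 + 1) + r)) atTop (𝓝 0) := by
    intro r
    induction r using Nat.twoStepInduction with
    | zero => intro _; exact hlim.congr fun n => (hblock n).1.symm
    | one => intro _; exact hWlim.congr fun n => (hblock n).2.symm
    | more r h1 h2 =>
      intro hr
      have h3 := (h1 (by omega)).sub ((h2 (by omega)).const_mul (x (r + 1) : ℂ))
      rw [mul_zero, sub_zero] at h3
      refine h3.congr fun n => ?_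
      have := hrec (n * (l + 1 + 1) + r)
      rw [hβx n r (by omega)] at this
      rw [this]
      push_cast
      ring_nf
  have hzlim : Tendsto z atTop (𝓝 0) := by
    rw [tendsto_zero_iff_norm_tendsto_zero, Metric.tendsto_atTop]
    intro ε hε
    have h1 : ∀ᶠ n in atTop, ∀ r ∈ Finset.range (l + 1 + 1), ‖z (n * (l + 1 + 1) + r)‖ < ε := by
      rw [Filter.eventually_all_finset]
      intro r hr
      exact (tendsto_zero_iff_norm_tendsto_zero.1
        (hres r (Nat.lt_succ_iff.1 (Finset.mem_range.1 hr)))).eventually (gt_mem_nhds hε)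
    obtain ⟨N, hN⟩ := eventually_atTop.1 h1
    refine ⟨N * (l + 1 + 1), fun j hj => ?_⟩
    have := hN (j / (l + 1 + 1)) ((Nat.le_div_iff_mul_le (by omega)).2 hj) (j % (l + 1 + 1))
      (Finset.mem_range.2 (Nat.mod_lt _ (by omega)))
    rw [Nat.div_add_mod'] at this
    simpa using this
  have hne' : z 0 ≠ 0 ∨ z 1 ≠ 0 := by
    by_contra! hc
    rw [hz0, hz1] at hc
    have := hWmul 0
    rw [hc.1, hc.2, mul_zero, mul_zero, zero_add, eq_comm, mul_eq_zero] at this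
    rcases hne with h | h
    · exact h hc.1
    · exact this.elim (pow_ne_zero _ (by norm_num)) h
  obtain ⟨h0, h1⟩ := convergesTo_of_tendsto_zero β hβ z hrec hzlim hne'
  rw [hz0] at h0 h1
  refine ⟨h0, ?_⟩
  convert h1 using 1
  rw [hz1, hW]
  field_simp

/-! ### The interlaced sequence and nonvanishing of the q-products -/

theorem interlaced_block_lt (k : ℕ) (x : ℕ → ℕ) (u v : ℕ → ℝ) (n j : ℕ) (hj : j < k) :
    interlaced k x u v (n * (k + 1) + j) = x (j + 1) := by
  have h1 : (n * (k + 1) + j) % (k + 1) = j := by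
    rw [Nat.mul_add_mod', Nat.mod_eq_of_lt (by omega)]
  rw [interlaced, h1, if_pos hj]

theorem interlaced_block_last (k : ℕ) (x : ℕ → ℕ) (u v : ℕ → ℝ) (n : ℕ) :
    interlaced k x u v (n * (k + 1) + k) = if Even n then u (n / 2 + 1) else v (n / 2 + 1) := by
  have h1 : (n * (k + 1) + k) % (k + 1) = k := by
    rw [Nat.mul_add_mod', Nat.mod_eq_of_lt (by omega)]
  have h2 : (n * (k + 1) + k) / (k + 1) = n := by
    rw [mul_comm, Nat.mul_add_div (by omega), Nat.div_eq_of_lt (by omega), add_zero]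
  rw [interlaced, h1, h2, if_neg (lt_irrefl k)]

theorem interlaced_exists_int (k : ℕ) (x : ℕ → ℕ) (u v : ℕ → ℝ)
    (hu : ∀ n, ∃ i : ℤ, u (n + 1) = i) (hv : ∀ n, ∃ i : ℤ, v (n + 1) = i) (j : ℕ) :
    ∃ i : ℤ, interlaced k x u v j = i := by
  unfold interlaced
  split_ifs
  · exact ⟨x (j % (k + 1) + 1), by push_cast; rfl⟩
  · exact hu _
  · exact hv _

theorem two_le_norm_intCast {m : ℤ} (hm : 1 < m) : 2 ≤ ‖(m : ℂ)‖ := by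
  rw [Complex.norm_intCast]
  have : (2 : ℝ) ≤ m := by exact_mod_cast hm
  exact this.trans (le_abs_self _)

theorem complex_sqrt_mul_self (z : ℂ) : Complex.sqrt z * Complex.sqrt z = z := by
  rw [← sq, Complex.sqrt]
  exact_mod_cast Complex.cpow_nat_inv_pow z two_ne_zero

/-- A zero of `d Q_k m^n + a` forces `d Q_k m^n = 1`. -/
theorem mul_pow_eq_one_of_add_eq_zero (c m : ℤ) (hm : 1 < m) (k : ℕ) (x : ℕ → ℕ)
    (hx : ∀ i, 1 ≤ i → i ≤ k → 0 < x i) (C E : ℝ)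
    (hC : C = cfDen x (k - 1) + cfNum x k + c * cfDen x k) (d : ℚ)
    (hCdm : ∃ N : ℕ, 0 < N ∧ C * d * m / E = N) (hdm : ∃ M : ℕ, 0 < M ∧ d * m = M)
    (a b : ℂ) (hab : a + b = E) (hab' : a * b = -((-1) ^ k * E / C)) (n : ℕ)
    (h0 : (d : ℂ) * cfDen x k * (m : ℂ) ^ (n + 1) + a = 0) :
    (d : ℝ) * cfDen x k * (m : ℝ) ^ (n + 1) = 1 := by
  obtain ⟨N, hN, hN'⟩ := hCdm
  obtain ⟨M, hM, hM'⟩ := hdm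
  have hM'' : (d : ℝ) * m = M := by exact_mod_cast congrArg (Rat.cast : ℚ → ℝ) hM'
  have hN0 : (N : ℝ) ≠ 0 := by exact_mod_cast hN.ne'
  have hC0 : C ≠ 0 := fun h => hN0 (by rw [← hN', h]; simp)
  have hE0 : E ≠ 0 := fun h => hN0 (by rw [← hN', h]; simp)
  set T : ℝ := (d : ℝ) * cfDen x k * (m : ℝ) ^ (n + 1) with hT
  have ha : a = -(T : ℂ) := by
    rw [hT]; push_cast; linear_combination h0
  have hb : b = E + T := by rw [← hab, ha]; ring
  rw [ha, hb] at hab'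
  have h1 : -T * (E + T) = -((-1) ^ k * E / C) := by exact_mod_cast hab'
  -- Both factors are integers, since dm and Cdm/E are; hence T is a unit, and it is positive.
  have h2 : (C + C / E * T) * T = (-1) ^ k := by
    field_simp at h1 ⊢
    linear_combination -h1
  have hints := simpleCF_exists_int (fun j => (x (j + 1) : ℝ)) fun j => ⟨x (j + 1), by simp⟩
  obtain ⟨q, hq⟩ := (hints k).2
  obtain ⟨q', hq'⟩ := (hints (k - 1)).2
  obtain ⟨p, hp⟩ := (hints k).1
  change cfDen x k = q at hq
  change cfDen x (k - 1) = q' at hq'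
  change cfNum x k = p at hp
  have hTint : T = ((M * q * m ^ n : ℤ) : ℝ) := by
    rw [hT, hq]; push_cast; rw [← hM'']; ring
  have hCint : C + C / E * T = ((q' + p + c * q + N * q * m ^ n : ℤ) : ℝ) := by
    push_cast
    rw [← hN', hT, hq, hC, hq', hp, hq]
    ring
  have hq1 : (1 : ℤ) ≤ q := by
    have := one_le_cfDen x k hx k le_rfl
    rw [hq] at this
    exact_mod_cast this
  rw [hCint, hTint] at h2
  have h3 : (q' + p + c * q + N * q * m ^ n) * (M * q * m ^ n) = (-1) ^ k := by exact_mod_cast h2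
  have h4 : IsUnit (M * q * m ^ n : ℤ) :=
    isUnit_of_mul_isUnit_right (h3 ▸ (isUnit_one.neg.pow k))
  have h5 : (0 : ℤ) < M * q * m ^ n := by positivity
  rcases Int.isUnit_iff.1 h4 with h | h
  · rw [hTint, h]; simp
  · omega

/-- A zero would give (dm) Q_k m^n = 1, but Q_k ≥ 2 if k ≥ 2 and m^n ≥ 2 if n ≥ 1. Only k = 1, n = 0
escapes, hence the extra assumption for odd k. -/
theorem mul_pow_add_ne_zero (c m : ℤ) (hm : 1 < m) (k : ℕ) (x : ℕ → ℕ)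
    (hx : ∀ i, 1 ≤ i → i ≤ k → 0 < x i) (C E : ℝ)
    (hC : C = cfDen x (k - 1) + cfNum x k + c * cfDen x k) (d : ℚ)
    (hCdm : ∃ N : ℕ, 0 < N ∧ C * d * m / E = N) (hdm : ∃ M : ℕ, 0 < M ∧ d * m = M)
    (a b : ℂ) (hab : a + b = E) (hab' : a * b = -((-1) ^ k * E / C)) (n : ℕ)
    (h : 2 ≤ k ∨ 1 ≤ n) :
    (d : ℂ) * cfDen x k * (m : ℂ) ^ (n + 1) + a ≠ 0 := by
  intro h0
  have h1 := mul_pow_eq_one_of_add_eq_zero c m hm k x hx C E hC d hCdm hdm a b hab hab' n h0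
  obtain ⟨M, hM, hM'⟩ := hdm
  have hM'' : (d : ℝ) * m = M := by exact_mod_cast congrArg (Rat.cast : ℚ → ℝ) hM'
  have h2 : (M : ℝ) * (cfDen x k * (m : ℝ) ^ n) = 1 := by
    rw [← hM'', ← h1]; ring
  have hM1 : (1 : ℝ) ≤ M := by exact_mod_cast hM
  have hm2 : (2 : ℝ) ≤ m := by exact_mod_cast hm
  have h3 : 2 ≤ cfDen x k * (m : ℝ) ^ n := by
    rcases h with h | h
    · have hq := two_le_cfDen x k hx h
      have := one_le_pow₀ (M₀ := ℝ) (a := m) (by linarith) (n := n)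
      nlinarith
    · have hq := one_le_cfDen x k hx k le_rfl
      have := le_self_pow₀ (M₀ := ℝ) (a := m) (by linarith) (n := n) (by omega)
      nlinarith
  nlinarith

/-! ### Assembly -/

/-- The value of the continued fraction, given roots `a`, `b` of `t² - E t - (-1)^k E / C`. -/
theorem interlaced_value (c e m : ℤ) (hm : 1 < m)
    (k : ℕ) (hk : 1 ≤ k) (x : ℕ → ℕ) (hx : ∀ i, 1 ≤ i → i ≤ k → 0 < x i)
    (C E : ℝ) (hC : C = cfDen x (k - 1) + cfNum x k + c * cfDen x k)
    (hE : E = cfDen x (k - 1) + cfNum x k + e * cfDen x k)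
    (d : ℚ) (hd : 0 < d)
    (hCdm : ∃ N : ℕ, 0 < N ∧ C * d * m / E = N)
    (hdm : ∃ M : ℕ, 0 < M ∧ d * m = M) (a b κ : ℂ) (hκ : κ = (-1) ^ k * E / C)
    (hab : a + b = E) (hab' : a * b = -κ)
    (h1 : (m : ℂ) * d * cfDen x k + a ≠ 0) :
    (∀ n, qPoch (-a / (d * cfDen x k * (m : ℂ) ^ 2)) (1 / m) n ≠ 0) ∧
    (∀ n, qPoch (-a / (d * cfDen x k * (m : ℂ))) (1 / m) n ≠ 0) ∧
    Summable (qTerm 3 (b / (d * cfDen x k)) (-a / (d * cfDen x k * (m : ℂ) ^ 2)) m) ∧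
    Summable (qTerm 1 (b / (d * cfDen x k)) (-a / (d * cfDen x k * (m : ℂ))) m) ∧
    (∑' n, qTerm 1 (b / (d * cfDen x k)) (-a / (d * cfDen x k * (m : ℂ))) m n) ≠ 0 ∧
    CFConvergesTo (simpleCF (interlaced k x
      (fun n => c + C / E * d * (m : ℝ) ^ (2 * n - 1)) (fun n => e + d * (m : ℝ) ^ (2 * n))))
      ((cfNum x k : ℂ) / cfDen x k +
        κ / (cfDen x k * ((m : ℂ) * d * cfDen x k + a)) *
          ((∑' n, qTerm 3 (b / (d * cfDen x k)) (-a / (d * cfDen x k * (m : ℂ) ^ 2)) m n) /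
            (∑' n, qTerm 1 (b / (d * cfDen x k)) (-a / (d * cfDen x k * (m : ℂ))) m n))) := by
  have hCE : C ≠ 0 ∧ E ≠ 0 := by
    obtain ⟨N, hN, hN'⟩ := hCdm
    have hN0 : (N : ℝ) ≠ 0 := by exact_mod_cast hN.ne'
    exact ⟨fun h => hN0 (by rw [← hN', h]; simp), fun h => hN0 (by rw [← hN', h]; simp)⟩
  obtain ⟨hC0, hE0⟩ := hCE
  have hCC : (C : ℂ) ≠ 0 := by exact_mod_cast hC0
  have hEC : (E : ℂ) ≠ 0 := by exact_mod_cast hE0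
  have hQ1 := one_le_cfDen x k hx k le_rfl
  have hQ : cfDen x k ≠ 0 := by linarith
  have hQC : (cfDen x k : ℂ) ≠ 0 := by exact_mod_cast hQ
  have hm2 := two_le_norm_intCast hm
  have hm0 := ne_zero_of_two_le_norm hm2
  have hκ0 : κ ≠ 0 := by
    rw [hκ]; exact div_ne_zero (mul_ne_zero (pow_ne_zero _ (by norm_num)) hEC) hCC
  have ha0 : a ≠ 0 := by
    rintro rfl; rw [zero_mul, eq_comm, neg_eq_zero] at hab'; exact hκ0 hab'
  have hb0 : b ≠ 0 := by
    rintro rfl; rw [mul_zero, eq_comm, neg_eq_zero] at hab'; exact hκ0 hab'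
  have hne : ∀ n : ℕ, (d : ℂ) * cfDen x k * (m : ℂ) ^ (n + 1) + a ≠ 0 := by
    intro n
    rcases Nat.eq_zero_or_pos n with rfl | hn
    · convert h1 using 2; ring
    · exact mul_pow_add_ne_zero c m hm k x hx C E hC d hCdm hdm a b hab (hκ ▸ hab') n (Or.inr hn)
  have hdC : (d : ℂ) ≠ 0 := by exact_mod_cast hd.ne'
  obtain ⟨D, hD⟩ : ∃ D : ℂ, D = d * cfDen x k := ⟨_, rfl⟩
  have hD0 : D ≠ 0 := hD ▸ mul_ne_zero hdC hQC
  have hmD : (m : ℂ) * d * cfDen x k + a = D * m + a := by rw [hD]; ring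
  rw [hmD] at h1 ⊢
  rw [← hD] at hne ⊢
  have hT3 := qTerm_eq_minTerm (b := b) hD0 hm0 hne 1
  have hT1 := qTerm_eq_minTerm (b := b) hD0 hm0 hne 0
  have hp3 := qPoch_ne_zero hD0 hm0 hne 1
  have hp1 := qPoch_ne_zero hD0 hm0 hne 0
  simp only [zero_add, pow_one, mul_zero, mul_one, one_add_one_eq_two] at hT3 hT1 hp3 hp1
  have hS0 : shiftedProd a D m 0 = 1 := rfl
  have hS1 : shiftedProd a D m 1 = D * m + a := by simp [shiftedProd]
  have hT3' : qTerm 3 (b / D) (-a / (D * (m : ℂ) ^ 2)) m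
      = fun i => (D * m + a) * minTerm a b D m 1 i := funext fun i => by rw [← hS1]; exact hT3 i
  have hT1' : qTerm 1 (b / D) (-a / (D * (m : ℂ))) m = minTerm a b D m 0 :=
    funext fun i => by rw [hT1, hS0, one_mul]
  have hs1 := summable_minTerm (a := a) (b := b) hD0 hm2 1
  have hs0 := summable_minTerm (a := a) (b := b) hD0 hm2 0
  rw [hT3', hT1', tsum_mul_left, ← minSol, ← minSol]
  obtain ⟨r, hr⟩ : ∃ r : ℂ, r = E / C := ⟨_, rfl⟩
  have hr0 : r ≠ 0 := hr ▸ div_ne_zero hEC hCC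
  have hrC : r * C = E := hr ▸ div_mul_cancel₀ _ hCC
  have hκr : κ = (-1) ^ k * r := by rw [hκ, hr]; ring
  -- The power of r rises from even n to n + 1: there E + D m^(n+1) is divided by r = E/C, while for
  -- odd n it stays. Any two steps gain one r, which turns -ab = (-1)^k r into (-1)^k.
  set Z : ℕ → ℂ := fun n => r ^ ((n + 1) / 2) * minSol a b D m n with hZdef
  have hZlim : Tendsto Z atTop (𝓝 0) := by
    refine tendsto_mul_minSol hD0 hm2 hne _ (max 1 ‖r‖) fun n => ?_
    obtain ⟨t, rfl | rfl⟩ := Nat.even_or_odd' n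
    · rw [show (2 * t + 1 + 1) / 2 = t + 1 by omega, show (2 * t + 1) / 2 = t by omega, pow_succ',
        norm_mul]
      exact mul_le_mul_of_nonneg_right (le_max_right _ _) (norm_nonneg _)
    · rw [show (2 * t + 1 + 1 + 1) / 2 = t + 1 by omega, show (2 * t + 1 + 1) / 2 = t + 1 by omega]
      exact le_mul_of_one_le_left (norm_nonneg _) (le_max_left _ _)
  have hβint : ∀ n, ∃ i : ℤ, interlaced k x
      (fun n => c + C / E * d * (m : ℝ) ^ (2 * n - 1)) (fun n => e + d * (m : ℝ) ^ (2 * n)) n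
        = i := by
    obtain ⟨N, -, hN⟩ := hCdm
    obtain ⟨M, -, hM⟩ := hdm
    have hM' : (d : ℝ) * m = M := by exact_mod_cast congrArg (Rat.cast : ℚ → ℝ) hM
    refine interlaced_exists_int k x _ _ (fun n => ⟨c + N * m ^ (2 * n), ?_⟩)
      (fun n => ⟨e + M * m ^ (2 * n + 1), ?_⟩)
    · push_cast
      rw [← hN, show 2 * (n + 1) - 1 = 2 * n + 1 by omega]
      ring
    · push_cast
      rw [← hM']
      ring
  -- Blocks are numbered from 0, so the exponents 2n - 1 and 2n both read n + 1 here.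
  have hZrec : ∀ n, Z n = (cfDen x (k - 1) + cfNum x k + cfDen x k *
      ((if Even n then c + C / E * d * (m : ℝ) ^ (n + 1) else e + d * (m : ℝ) ^ (n + 1) : ℝ) : ℂ))
        * Z (n + 1) + (-1) ^ k * Z (n + 2) := by
    intro n
    have hrec := minSol_recurrence (b := b) hD0 hm2 hne n
    rw [hab, hab', hκr] at hrec
    have hCc : (C : ℂ) = cfDen x (k - 1) + cfNum x k + c * cfDen x k := by exact_mod_cast hC
    have hEc : (E : ℂ) = cfDen x (k - 1) + cfNum x k + e * cfDen x k := by exact_mod_cast hE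
    obtain ⟨t, rfl | rfl⟩ := Nat.even_or_odd' n
    · simp only [hZdef]
      rw [if_pos (even_two_mul t), show (2 * t + 1 + 1) / 2 = t + 1 by omega,
        show (2 * t + 1) / 2 = t by omega, show (2 * t + 2 + 1) / 2 = t + 1 by omega, hrec]
      have hrE : r * (C / E) = 1 := by rw [hr]; field_simp
      push_cast
      linear_combination (r ^ (t + 1) * minSol a b D m (2 * t + 1)) * hCc
        - (r ^ t * minSol a b D m (2 * t + 1)) * hrC
        - (r ^ t * d * cfDen x k * m ^ (2 * t + 1) * minSol a b D m (2 * t + 1)) * hrE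
        + (r ^ t * m ^ (2 * t + 1) * minSol a b D m (2 * t + 1)) * hD
    · simp only [hZdef]
      rw [if_neg (by simp), show (2 * t + 1 + 1 + 1) / 2 = t + 1 by omega,
        show (2 * t + 1 + 1) / 2 = t + 1 by omega, show (2 * t + 1 + 2 + 1) / 2 = t + 2 by omega,
        hrec]
      push_cast
      linear_combination (r ^ (t + 1) * minSol a b D m (2 * t + 1 + 1)) * hEc
        + (r ^ (t + 1) * m ^ (2 * t + 1 + 1) * minSol a b D m (2 * t + 1 + 1)) * hD
  have hZne : Z 0 ≠ 0 ∨ Z 1 ≠ 0 := by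
    refine (minSol_ne_zero_or hD0 hm2 hne ha0 hb0).imp (fun h => ?_) fun h => ?_
    · simpa [hZdef] using h
    · simpa [hZdef, hr0] using h
  obtain ⟨h0, hconv⟩ := block_convergesTo k hk x hQ _ _ hβint
    (fun n j hj => interlaced_block_lt k x _ _ n j hj)
    (fun n => by
      rw [interlaced_block_last]
      obtain ⟨t, rfl | rfl⟩ := Nat.even_or_odd' n
      · rw [if_pos (even_two_mul t), if_pos (even_two_mul t),
          show 2 * (2 * t / 2 + 1) - 1 = 2 * t + 1 by omega]
      · rw [if_neg (by simp), if_neg (by simp),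
          show 2 * ((2 * t + 1) / 2 + 1) = 2 * t + 1 + 1 by omega]) Z hZrec hZlim hZne
  have hZ0 : Z 0 = minSol a b D m 0 := by simp [hZdef]
  have hZ1 : Z 1 = r * minSol a b D m 1 := by simp [hZdef]
  rw [hZ0] at h0
  refine ⟨hp3, hp1, hs1.mul_left _, hs0, h0, ?_⟩
  -- The factor D m + a normalizing the s = 3 series cancels the one in the stated value.
  convert hconv using 1
  rw [hZ0, hZ1, hκr]
  field_simp

theorem mainTheorem7 (c e m : ℤ) (hm : 1 < m)
    (k : ℕ) (hk : 1 ≤ k) (x : ℕ → ℕ) (hx : ∀ i, 1 ≤ i → i ≤ k → 0 < x i)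
    (P Q : ℕ → ℝ) (hP : P = cfNum x) (hQ : Q = cfDen x)
    (C E : ℝ) (hC : C = Q (k - 1) + P k + c * Q k) (hE : E = Q (k - 1) + P k + e * Q k)
    (d : ℚ) (hd : 0 < d)
    (hCdm : ∃ N : ℕ, 0 < N ∧ C * d * m / E = N)
    (hdm : ∃ M : ℕ, 0 < M ∧ d * m = M)
    (g : GenContFract ℝ)
    (hg : g = simpleCF (interlaced k x
      (fun n => c + C / E * d * (m : ℝ) ^ (2 * n - 1)) (fun n => e + d * (m : ℝ) ^ (2 * n)))) :
    (Even k → ∀ a b : ℂ,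
      a = (E - Complex.sqrt ((E : ℂ) ^ 2 + 4 * E / C)) / 2 →
      b = (E + Complex.sqrt ((E : ℂ) ^ 2 + 4 * E / C)) / 2 →
      (m : ℂ) * d * Q k + a ≠ 0 ∧
      (∀ n, qPoch (-a / (d * Q k * (m : ℂ) ^ 2)) (1 / m) n ≠ 0) ∧
      (∀ n, qPoch (-a / (d * Q k * (m : ℂ))) (1 / m) n ≠ 0) ∧
      Summable (qTerm 3 (b / (d * Q k)) (-a / (d * Q k * (m : ℂ) ^ 2)) m) ∧
      Summable (qTerm 1 (b / (d * Q k)) (-a / (d * Q k * (m : ℂ))) m) ∧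
      (∑' n, qTerm 1 (b / (d * Q k)) (-a / (d * Q k * (m : ℂ))) m n) ≠ 0 ∧
      CFConvergesTo g ((P k : ℂ) / Q k +
        ((E : ℂ) / C) / (Q k * ((m : ℂ) * d * Q k + a)) *
          ((∑' n, qTerm 3 (b / (d * Q k)) (-a / (d * Q k * (m : ℂ) ^ 2)) m n) /
            (∑' n, qTerm 1 (b / (d * Q k)) (-a / (d * Q k * (m : ℂ))) m n)))) ∧
    (Odd k → ∀ a b : ℂ,
      a = (E - Complex.sqrt ((E : ℂ) ^ 2 - 4 * E / C)) / 2 →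
      b = (E + Complex.sqrt ((E : ℂ) ^ 2 - 4 * E / C)) / 2 →
      (m : ℂ) * d * Q k + a ≠ 0 →
      (∀ n, qPoch (-a / (d * Q k * (m : ℂ) ^ 2)) (1 / m) n ≠ 0) ∧
      (∀ n, qPoch (-a / (d * Q k * (m : ℂ))) (1 / m) n ≠ 0) ∧
      Summable (qTerm 3 (b / (d * Q k)) (-a / (d * Q k * (m : ℂ) ^ 2)) m) ∧
      Summable (qTerm 1 (b / (d * Q k)) (-a / (d * Q k * (m : ℂ))) m) ∧
      (∑' n, qTerm 1 (b / (d * Q k)) (-a / (d * Q k * (m : ℂ))) m n) ≠ 0 ∧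
      CFConvergesTo g ((P k : ℂ) / Q k +
        (-(E : ℂ) / C) / (Q k * ((m : ℂ) * d * Q k + a)) *
          ((∑' n, qTerm 3 (b / (d * Q k)) (-a / (d * Q k * (m : ℂ) ^ 2)) m n) /
            (∑' n, qTerm 1 (b / (d * Q k)) (-a / (d * Q k * (m : ℂ))) m n)))) := by
  subst hP hQ hg
  refine ⟨fun hk' a b ha hb => ?_, fun hk' a b ha hb h1 => ?_⟩
  -- Only the square of the root matters: a and b enter through their sum and product.
  · have hs := complex_sqrt_mul_self ((E : ℂ) ^ 2 + 4 * E / C)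
    have hab : a + b = E := by rw [ha, hb]; ring
    have hab' : a * b = -((E : ℂ) / C) := by
      rw [ha, hb]; linear_combination (-1 / 4 : ℂ) * hs
    have hκ : (E : ℂ) / C = (-1) ^ k * E / C := by rw [hk'.neg_one_pow, one_mul]
    have h1 : (m : ℂ) * d * cfDen x k + a ≠ 0 := by
      have h2 : 2 ≤ k := by obtain ⟨t, rfl⟩ := hk'; omega
      convert mul_pow_add_ne_zero c m hm k x hx C E hC d hCdm hdm a b hab (hκ ▸ hab') 0
        (Or.inl h2) using 2
      ring
    exact ⟨h1, interlaced_value c e m hm k hk x hx C E hC hE d hd hCdm hdm a b _ hκ hab hab' h1⟩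
  · have hs := complex_sqrt_mul_self ((E : ℂ) ^ 2 - 4 * E / C)
    have hab : a + b = E := by rw [ha, hb]; ring
    have hab' : a * b = -(-(E : ℂ) / C) := by
      rw [ha, hb]; linear_combination (-1 / 4 : ℂ) * hs
    have hκ : -(E : ℂ) / C = (-1) ^ k * E / C := by rw [hk'.neg_one_pow, neg_one_mul]
    exact interlaced_value c e m hm k hk x hx C E hC hE d hd hCdm hdm a b _ hκ hab hab' h1
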